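/- Let $m,k\ge 0$ be integers, $n=m+k$, and $\alpha\in\mathbb{Q}$. For a sequence $h=(h_1,h_2,\dots)$ in a commutative ring, with $h_0=1$ and $h_i=0$ for $i<0$, and integers $\lambda_1\ge\dots\ge\lambda_\ell\ge 0$, put $\Delta_\lambda(h)=\det(h_{\lambda_i+j-i})_{1\le i,j\le \ell}$. Let $S=\mathbb{Q}[c_1,\dots,c_m]$ with $\deg c_i=i$, put $c_i=0$ for $i>m$, and let $\sigma_p=\Delta_{(1^p)}(c)=\det(c_{1+j-i})_{p\times p}$. A partition $\lambda\subset m\times k$ is a sequence $k\ge\lambda_1\ge\dots\ge\lambda_m\ge0$ of integers; its weight is $|\lambda|=\sum_i\lambda_i$, and $\sigma_\lambda=\Delta_\lambda(\sigma)=\det(\sigma_{\lambda_i+j-i})_{m\times m}$. Consider the $\mathbb{Q}[q]$-algebra $$\mathrm{QH}_\alpha=S[q]/\langle \sigma_{k+1},\dots,\sigma_{n-1},\ \sigma_n+(-1)^m\alpha q\rangle,$$ graded by $\deg q=n$ and $\deg c_p=p$, and write $\sigma_\lambda$ also for the image of $\sigma_\lambda$ in $\mathrm{QH}_\alpha$.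 **Theorem.** Let $\{\tau_\lambda : \lambda\subset m\times k\}$ be any basis of $\mathrm{QH}_\alpha$ as a $\mathbb{Q}[q]$-module such that 1. $\tau_\lambda$ is homogeneous of degree $|\lambda|$ for every $\lambda$; 2. $\tau_\lambda-\sigma_\lambda\in\langle q\rangle$ for every $\lambda$, where $\langle q\rangle\subset \mathrm{QH}_\alpha$ is the ideal generated by $q$; 3. the structure constants $N_{\lambda,\mu}^{\nu,d}\in\mathbb{Q}$ defined by $\tau_\lambda\tau_\mu=\sum_{\nu,\,d\ge0}N_{\lambda,\mu}^{\nu,d}\,q^d\tau_\nu$ are all non-negative. Then $\tau_\lambda=\sigma_\lambda$ for every $\lambda\subset m\times k$. -/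

import Mathlib

namespace QuantumGrassmannian

noncomputable section

/-- A sequence `(h 1, h 2, …)` extended to integer indices by `h₀ = 1` and `hᵢ = 0` for `i < 0`.
The value `h 0` is not used. -/
def extendSeq {R : Type*} [CommRing R] (h : ℕ → R) (i : ℤ) : R :=
  if i < 0 then 0 else if i = 0 then 1 else h i.toNat

/-- `Δ_a(h) = det (h_{aᵢ + j - i})`, a determinant of size `l × l`. -/
def Delta {R : Type*} [CommRing R] {l : ℕ} (a : Fin l → ℕ) (h : ℕ → R) : R :=
  Matrix.det (Matrix.of fun i j : Fin l => extendSeq h ((a i : ℤ) + (j : ℤ) - (i : ℤ)))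

/-- `S = ℚ[c₁, …, cₘ]`; the variable with index `i : Fin m` is `c_{i+1}`. -/
abbrev S (m : ℕ) : Type := MvPolynomial (Fin m) ℚ

/-- The sequence `(c₁, …, cₘ, 0, 0, …)` in `S`, read at indices `p ≥ 1`. -/
def c (m : ℕ) (p : ℕ) : S m :=
  if h : 1 ≤ p ∧ p ≤ m then MvPolynomial.X ⟨p - 1, by omega⟩ else 0

/-- The dual sequence `σ_p = Δ_{(1^p)}(c)`. -/
def sigma (m : ℕ) (p : ℕ) : S m :=
  Delta (fun _ : Fin p => 1) (c m)

/-- Partitions `k ≥ a₁ ≥ … ≥ aₘ ≥ 0`, that is, partitions contained in the rectangle `m × k`. -/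
abbrev RectPartition (m k : ℕ) : Type :=
  {a : Fin m → ℕ // Antitone a ∧ ∀ i, a i ≤ k}

/-- The weight `|a| = ∑ aᵢ`. -/
def RectPartition.weight {m k : ℕ} (a : RectPartition m k) : ℕ := ∑ i, a.1 i

/-- `σ_a = Δ_a(σ)` in `S`. -/
def sigmaPartition {m k : ℕ} (a : RectPartition m k) : S m :=
  Delta a.1 (sigma m)

/-- The ideal `⟨σ_{k+1}, …, σ_{n-1}, σ_n + (-1)^m α q⟩` of `S[q]`, where `n = m + k`. -/
def relations (m k : ℕ) (α : ℚ) : Ideal (Polynomial (S m)) :=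
  Ideal.span
    ({f | ∃ p : ℕ, k + 1 ≤ p ∧ p < m + k ∧ f = Polynomial.C (sigma m p)} ∪
      {Polynomial.C (sigma m (m + k)) +
        (-1) ^ m * Polynomial.C (MvPolynomial.C α) * Polynomial.X})

/-- `QH_α = S[q] / ⟨σ_{k+1}, …, σ_{n-1}, σ_n + (-1)^m α q⟩`. -/
def QH (m k : ℕ) (α : ℚ) : Type := Polynomial (S m) ⧸ relations m k α

instance (m k : ℕ) (α : ℚ) : CommRing (QH m k α) :=
  inferInstanceAs (CommRing (Polynomial (S m) ⧸ relations m k α))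

/-- The quotient map `S[q] → QH_α`. -/
def QH.mk (m k : ℕ) (α : ℚ) : Polynomial (S m) →+* QH m k α :=
  Ideal.Quotient.mk (relations m k α)

/-- `QH_α` as a `ℚ[q]`-algebra, through `ℚ[q] → S[q] → QH_α`. -/
instance (m k : ℕ) (α : ℚ) : Algebra (Polynomial ℚ) (QH m k α) :=
  RingHom.toAlgebra ((QH.mk m k α).comp (Polynomial.mapRingHom MvPolynomial.C))

/-- The class of `q` in `QH_α`. -/
def QH.q (m k : ℕ) (α : ℚ) : QH m k α := QH.mk m k α Polynomial.X

/-- The class of `σ_a` in `QH_α`. -/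
def QH.sigma {m k : ℕ} (α : ℚ) (a : RectPartition m k) : QH m k α :=
  QH.mk m k α (Polynomial.C (sigmaPartition a))

/-- Homogeneity of degree `D` in `S[q]` for the grading with `deg c_p = p` and
`deg q = n = m + k`: each nonzero coefficient of `q^d` is homogeneous in `S` of degree
`D - n d ≥ 0`. -/
def IsHomogeneousPoly (m k : ℕ) (f : Polynomial (S m)) (D : ℕ) : Prop :=
  ∀ d : ℕ, f.coeff d ≠ 0 → ∃ e : ℕ, e + (m + k) * d = D ∧
    MvPolynomial.IsWeightedHomogeneous (fun i : Fin m => (i : ℕ) + 1) (f.coeff d) e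

/-- Homogeneity of degree `D` in the quotient grading of `QH_α`. -/
def QH.IsHomogeneous {m k : ℕ} {α : ℚ} (x : QH m k α) (D : ℕ) : Prop :=
  ∃ f : Polynomial (S m), IsHomogeneousPoly m k f D ∧ QH.mk m k α f = x

/-- The structure constant `N^{w,d}_{u,v}` of a `ℚ[q]`-basis `τ` of `QH_α`, given by
`τ_u τ_v = ∑_{w,d} N^{w,d}_{u,v} q^d τ_w`. -/
def structureConstant {m k : ℕ} {α : ℚ}
    (τ : Module.Basis (RectPartition m k) (Polynomial ℚ) (QH m k α))
    (u v w : RectPartition m k) (d : ℕ) : ℚ :=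
  (τ.repr (τ u * τ v) w).coeff d

end

end QuantumGrassmannian

namespace QuantumGrassmannian

noncomputable section

/-! ### Dual sequences and the bialternant formula -/

section Sequences

variable {R : Type*} [CommRing R]

lemma extendSeq_of_neg (h : ℕ → R) {i : ℤ} (hi : i < 0) : extendSeq h i = 0 := by
  simp [extendSeq, hi]

@[simp] lemma extendSeq_zero (h : ℕ → R) : extendSeq h 0 = 1 := by
  simp [extendSeq]

lemma extendSeq_natCast (h : ℕ → R) {p : ℕ} (hp : p ≠ 0) : extendSeq h p = h p := by
  simp [extendSeq, hp]

lemma map_extendSeq {A : Type*} [CommRing A] (f : R →+* A) (h : ℕ → R) (i : ℤ) :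
    f (extendSeq h i) = extendSeq (fun p => f (h p)) i := by
  unfold extendSeq
  split_ifs <;> simp

lemma map_Delta {A : Type*} [CommRing A] (f : R →+* A) {l : ℕ} (a : Fin l → ℕ) (h : ℕ → R) :
    f (Delta a h) = Delta a (fun p => f (h p)) := by
  rw [Delta, Delta, RingHom.map_det]
  congr 1
  ext i j
  simp [map_extendSeq]

lemma Delta_congr {l : ℕ} (a : Fin l → ℕ) {h h' : ℕ → R} (hh : ∀ p, p ≠ 0 → h p = h' p) :
    Delta a h = Delta a h' := by
  have : extendSeq h = extendSeq h' := by
    ext i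
    unfold extendSeq
    split_ifs
    · rfl
    · rfl
    · exact hh _ (by omega)
  rw [Delta, Delta, this]

/-- `Δ_{(p)} = h_p`, with `(p)` padded by zeros. -/
lemma Delta_single {l : ℕ} (p : ℕ) (h : ℕ → R) :
    Delta (fun i : Fin (l + 1) => if i = 0 then p else 0) h = extendSeq h p := by
  rw [Delta, Matrix.det_of_isUpperTriangular, Fin.prod_univ_succ]
  · simp [Fin.succ_ne_zero]
  · intro i j hij
    have hij' : j < i := hij
    have h0 : i ≠ 0 := by rintro rfl; exact absurd hij' (by simp)
    simp only [Matrix.of_apply, h0, if_false]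
    apply extendSeq_of_neg
    have : (j : ℕ) < i := hij'
    push_cast
    omega

lemma Delta_zero {l : ℕ} (h : ℕ → R) : Delta (fun _ : Fin l => 0) h = 1 := by
  rw [Delta, Matrix.det_of_isUpperTriangular]
  · simp
  · intro i j hij
    have : (j : ℕ) < i := hij
    simp only [Matrix.of_apply]
    apply extendSeq_of_neg
    push_cast
    omega

/-- The determinants `Δ_{(1^p)}` are, up to sign, the coefficients of the inverse series. -/
lemma series_mul_series_Delta_one (h : ℕ → R) :
    PowerSeries.mk (fun i : ℕ => extendSeq h i) *
      PowerSeries.mk (fun p : ℕ => (-1) ^ p * Delta (fun _ : Fin p => 1) h) = 1 := by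
  set F := PowerSeries.mk (fun i : ℕ => extendSeq h i) with hF
  set g := PowerSeries.invOfUnit F 1 with hg
  have hFg : F * g = 1 := PowerSeries.mul_invOfUnit F 1 (by simp [hF])
  suffices H : PowerSeries.mk (fun p : ℕ => (-1) ^ p * Delta (fun _ : Fin p => 1) h) = g by
    rw [H, hFg]
  ext p
  rw [PowerSeries.coeff_mk]
  -- `A` is the unitriangular Toeplitz matrix of the series. The coefficients of the inverse series
  -- form a row `v` with `v A = e_0`, so `v` is row `0` of the adjugate, and its last entry is a
  -- signed minor: the determinant sought.
  set A : Matrix (Fin (p + 1)) (Fin (p + 1)) R :=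
    Matrix.of fun i j => extendSeq h ((j : ℤ) - (i : ℤ)) with hA
  have hdet : A.det = 1 := by
    rw [← Delta_zero (l := p + 1) h, Delta]
    congr 1
    ext i j
    simp [hA]
  set v : Fin (p + 1) → R := fun l => PowerSeries.coeff (l : ℕ) g with hv
  have hvA : Matrix.vecMul v A = Pi.single 0 1 := by
    ext j
    have h1 : PowerSeries.coeff (j : ℕ) (g * F) = if (j : ℕ) = 0 then 1 else 0 := by
      rw [mul_comm, hFg, PowerSeries.coeff_one]
    rw [PowerSeries.coeff_mul, Finset.Nat.sum_antidiagonal_eq_sum_range_succ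
      (fun a b => PowerSeries.coeff a g * PowerSeries.coeff b F)] at h1
    have h2 : (Pi.single 0 1 : Fin (p + 1) → R) j = if (j : ℕ) = 0 then 1 else 0 := by
      simp only [Pi.single_apply, Fin.ext_iff, Fin.val_zero]
    rw [h2, ← h1, Matrix.vecMul, dotProduct]
    simp only [hv, hA, Matrix.of_apply]
    rw [Fin.sum_univ_eq_sum_range
      (fun l => PowerSeries.coeff l g * extendSeq h ((j : ℤ) - (l : ℤ))) (p + 1)]
    symm
    have hsub : Finset.range (j + 1) ⊆ Finset.range (p + 1) :=
      Finset.range_subset_range.2 (by omega)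
    rw [← Finset.sum_subset hsub]
    · refine Finset.sum_congr rfl fun l hl => ?_
      have : l ≤ j := by simpa [Nat.lt_succ_iff] using hl
      simp [hF, this]
    · intro l _ hl
      have : (j : ℕ) < l := by simpa [Nat.lt_succ_iff] using hl
      rw [extendSeq_of_neg _ (by omega), mul_zero]
  have hrow : v = A.adjugate 0 := by
    have : Matrix.vecMul (Matrix.vecMul v A) A.adjugate = v := by
      rw [Matrix.vecMul_vecMul, Matrix.mul_adjugate, hdet, one_smul, Matrix.vecMul_one]
    rw [← this, hvA]
    ext j
    simp
  have hlast := congrFun hrow (Fin.last p)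
  rw [Matrix.adjugate_fin_succ_eq_det_submatrix] at hlast
  simp only [hv, Fin.val_last] at hlast
  rw [hlast]
  simp only [Fin.val_zero, add_zero, Fin.succAbove_last, Delta]
  congr 2
  ext i j
  simp [hA]
  congr 1
  ring

lemma series_Delta_one_mul_series (h : ℕ → R) :
    PowerSeries.mk (fun p : ℕ => Delta (fun _ : Fin p => 1) h) *
      PowerSeries.mk (fun i : ℕ => (-1) ^ i * extendSeq h i) = 1 := by
  have := congrArg (PowerSeries.rescale (-1 : R)) (series_mul_series_Delta_one h)
  rw [map_mul, map_one, mul_comm] at this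
  rw [← this]
  congr 1
  · ext p
    simp [PowerSeries.coeff_rescale, ← mul_assoc, ← mul_pow]
  · ext p
    simp [PowerSeries.coeff_rescale]

/-- Powers of a root `y` of `y^m - e₁ y^(m-1) + ⋯ ± e_m` in terms of the dual sequence. -/
lemma exists_pow_eq_sum {m : ℕ} (e : ℕ → R) (he : ∀ p, m < p → e p = 0) (y : R)
    (hy : ∑ s ∈ Finset.range (m + 1), (-1) ^ s * extendSeq e s * y ^ (m - s) = 0) :
    ∃ u : ℕ → R, ∀ N : ℕ, y ^ N = ∑ r ∈ Finset.range m,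
      extendSeq (fun p => Delta (fun _ : Fin p => 1) e) ((N : ℤ) - r) * u r := by
  set E := PowerSeries.mk (fun i : ℕ => (-1) ^ i * extendSeq e i) with hE
  set H := PowerSeries.mk (fun p : ℕ => Delta (fun _ : Fin p => 1) e) with hH
  set Y := PowerSeries.mk (fun N : ℕ => y ^ N) with hY
  have hHY : H * (E * Y) = Y := by
    rw [← mul_assoc, series_Delta_one_mul_series, one_mul]
  refine ⟨fun r => PowerSeries.coeff r (E * Y), fun N => ?_⟩
  -- Since `Y = 1/(1 - yt)` and `y` is a root, `E * Y` is a polynomial of degree less than `m`; its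
  -- coefficients serve as `u`, independently of `N`.
  have hu : ∀ r, m ≤ r → PowerSeries.coeff r (E * Y) = 0 := by
    intro r hr
    rw [PowerSeries.coeff_mul, Finset.Nat.sum_antidiagonal_eq_sum_range_succ
      (fun a b => PowerSeries.coeff a E * PowerSeries.coeff b Y),
      ← Finset.sum_subset (Finset.range_subset_range.2 (Nat.succ_le_succ hr))]
    · rw [← mul_zero (y ^ (r - m)), ← hy, Finset.mul_sum]
      refine Finset.sum_congr rfl fun s hs => ?_
      have hs' : s ≤ m := by simpa [Nat.lt_succ_iff] using hs
      have : r - s = (r - m) + (m - s) := by omega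
      simp only [hE, hY, PowerSeries.coeff_mk, this, pow_add]
      ring
    · intro s _ hs
      have hs' : m < s := by simpa [Nat.lt_succ_iff] using hs
      simp [hE, extendSeq_natCast e (show s ≠ 0 by omega), he s hs']
  have hN : PowerSeries.coeff N Y = y ^ N := by simp [hY]
  rw [← hN]
  conv_lhs => rw [← hHY]
  rw [mul_comm, PowerSeries.coeff_mul, Finset.Nat.sum_antidiagonal_eq_sum_range_succ
      (fun a b => PowerSeries.coeff a (E * Y) * PowerSeries.coeff b H)]
  have key : ∀ r ∈ Finset.range (N + 1),
      PowerSeries.coeff r (E * Y) * PowerSeries.coeff (N - r) H =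
      extendSeq (fun p => Delta (fun _ : Fin p => 1) e) ((N : ℤ) - r) *
        PowerSeries.coeff r (E * Y) := by
    intro r hr
    have hr' : r ≤ N := by simpa [Nat.lt_succ_iff] using hr
    rw [mul_comm]
    congr 1
    rw [hH, PowerSeries.coeff_mk, ← Nat.cast_sub hr']
    by_cases h0 : N - r = 0
    · rw [h0]
      simp [Delta]
    · rw [extendSeq_natCast _ h0]
  rw [Finset.sum_congr rfl key]
  have e1 := Finset.sum_subset (Finset.range_subset_range.2 (le_max_left (N + 1) m))
    (f := fun r : ℕ => extendSeq (fun p => Delta (fun _ : Fin p => 1) e) ((N : ℤ) - r) *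
        PowerSeries.coeff r (E * Y)) (by
      intro r _ hr
      have hr' : N < r := by simpa [Nat.lt_succ_iff] using hr
      rw [extendSeq_of_neg _ (by omega), zero_mul])
  have e2 := Finset.sum_subset (Finset.range_subset_range.2 (le_max_right (N + 1) m))
    (f := fun r : ℕ => extendSeq (fun p => Delta (fun _ : Fin p => 1) e) ((N : ℤ) - r) *
        PowerSeries.coeff r (E * Y)) (by
      intro r _ hr
      have hr' : m ≤ r := by simpa using hr
      rw [hu r hr', mul_zero])
  rw [e1, e2]

/-- The alternant `det (x_i ^ e_j)`. -/
def alternant {m : ℕ} (x : Fin m → R) (e : Fin m → ℕ) : R :=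
  Matrix.det (Matrix.of fun i j => x i ^ e j)

/-- The exponent vector `a + (m-1, m-2, …, 0)`. -/
def shifted {m : ℕ} (a : Fin m → ℕ) (j : Fin m) : ℕ := a j + (m - 1 - j)

/-- The `i`-th elementary symmetric polynomial in the entries of `x`. -/
def elemSymm {m : ℕ} (x : Fin m → R) (i : ℕ) : R := (Finset.univ.val.map x).esymm i

lemma elemSymm_eq_zero {m : ℕ} (x : Fin m → R) {p : ℕ} (hp : m < p) : elemSymm x p = 0 := by
  rw [elemSymm, Multiset.esymm, Multiset.powersetCard_eq_empty _ (by simpa using hp)]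
  simp

lemma extendSeq_elemSymm {m : ℕ} (x : Fin m → R) (s : ℕ) :
    extendSeq (elemSymm x) s = elemSymm x s := by
  by_cases h0 : s = 0
  · rw [h0, Nat.cast_zero, extendSeq_zero, elemSymm, Multiset.esymm,
      Multiset.powersetCard_zero_left]
    simp
  · exact extendSeq_natCast _ h0

lemma elemSymm_root {m : ℕ} (x : Fin m → R) (i : Fin m) :
    ∑ s ∈ Finset.range (m + 1), (-1) ^ s * extendSeq (elemSymm x) s * x i ^ (m - s) = 0 := by
  have := congrArg (Polynomial.eval (x i))
    (Multiset.prod_X_sub_X_eq_sum_esymm (Finset.univ.val.map x))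
  rw [Polynomial.eval_multiset_prod, Multiset.prod_eq_zero] at this
  · rw [this, Polynomial.eval_finsetSum]
    simp only [Multiset.card_map, Finset.card_val, Finset.card_univ, Fintype.card_fin]
    refine Finset.sum_congr rfl fun s _ => ?_
    rw [extendSeq_elemSymm]
    simp [elemSymm, mul_assoc]
  · simp only [Multiset.map_map, Multiset.mem_map]
    exact ⟨i, by simp, by simp⟩

/-- The bialternant formula. -/
lemma Delta_mul_alternant {m : ℕ} (x : Fin m → R) (a : Fin m → ℕ) :
    Delta a (fun p => Delta (fun _ : Fin p => 1) (elemSymm x)) * alternant x (shifted 0) =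
      alternant x (shifted a) := by
  have H := fun i => exists_pow_eq_sum (elemSymm x) (fun p hp => elemSymm_eq_zero x hp) (x i)
    (elemSymm_root x i)
  choose u hu using H
  set h : ℕ → R := fun p => Delta (fun _ : Fin p => 1) (elemSymm x) with hh
  set U : Matrix (Fin m) (Fin m) R := Matrix.of fun i l => u i (m - 1 - l) with hU
  -- The alternant matrix factors as `U` times the transposed Jacobi–Trudi matrix, with `U`
  -- independent of `b`. Taking `b = 0` identifies `det U` with the Vandermonde determinant, so no
  -- division is needed.
  have key : ∀ b : Fin m → ℕ, alternant x (shifted b) = U.det * Delta b h := by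
    intro b
    rw [Delta, ← Matrix.det_transpose (Matrix.of fun i j : Fin m => extendSeq h _),
      ← Matrix.det_mul, alternant]
    congr 1
    ext i j
    rw [Matrix.of_apply, hu, Matrix.mul_apply, Finset.sum_range,
      ← Equiv.sum_comp Fin.revPerm]
    refine Finset.sum_congr rfl fun l _ => ?_
    rw [mul_comm]
    simp only [hU, Matrix.of_apply, Matrix.transpose_apply, Fin.revPerm_apply, Fin.val_rev]
    have hl := l.2
    have hj := j.2
    congr 2
    · omega
    · simp only [shifted]
      push_cast [show (l : ℕ) + 1 ≤ m by omega, show (j : ℕ) ≤ m - 1 by omega,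
        show 1 ≤ m by omega]
      ring
  have h0 := key 0
  rw [show Delta (0 : Fin m → ℕ) h = 1 from Delta_zero h, mul_one] at h0
  rw [key a, h0, mul_comm]

end Sequences

/-! ### The residue modulo `xᵢ^n = b` and its values on products of alternants -/

section Residue

variable {R : Type*} [CommRing R]

/-- The coefficient of `y^(n-1)` in `y^e`, reduced modulo `y^n = b`. -/
def powResidue (n : ℕ) (b : R) (e : ℕ) : R :=
  if e % n = n - 1 then b ^ (e / n) else 0

lemma powResidue_add_self {n : ℕ} (hn : 0 < n) (b : R) (e : ℕ) :
    powResidue n b (e + n) = b * powResidue n b e := by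
  simp only [powResidue, Nat.add_mod_right, Nat.add_div_right _ hn, pow_succ']
  split_ifs <;> simp

lemma powResidue_of_lt {n : ℕ} (hn : 0 < n) (b : R) {e : ℕ} (he : e < 2 * n - 1) :
    powResidue n b e = if e = n - 1 then 1 else 0 := by
  unfold powResidue
  by_cases h : e < n
  · rw [Nat.mod_eq_of_lt h, Nat.div_eq_of_lt h, pow_zero]
  · have h1 : e % n = e - n := by
      rw [Nat.mod_eq_sub_mod (by omega), Nat.mod_eq_of_lt (by omega)]
    rw [h1, if_neg (by omega), if_neg (by omega)]

/-- The coefficient of `∏ xᵢ^(n-1)`, after reduction modulo `xᵢ^n = b`. -/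
def residue (m n : ℕ) (b : R) : MvPolynomial (Fin m) R →ₗ[R] R :=
  (MvPolynomial.basisMonomials (Fin m) R).constr R fun e => ∏ i, powResidue n b (e i)

lemma residue_monomial {m : ℕ} (n : ℕ) (b : R) (e : Fin m →₀ ℕ) :
    residue m n b (MvPolynomial.monomial e 1) = ∏ i, powResidue n b (e i) := by
  have := (MvPolynomial.basisMonomials (Fin m) R).constr_basis R
    (fun e => ∏ i, powResidue n b (e i)) e
  rwa [MvPolynomial.coe_basisMonomials] at this

lemma residue_prod_pow {m : ℕ} (n : ℕ) (b : R) (e : Fin m → ℕ) :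
    residue m n b (∏ i, MvPolynomial.X i ^ e i) = ∏ i, powResidue n b (e i) := by
  have h := residue_monomial n b (Finsupp.equivFunOnFinite.symm e)
  rw [MvPolynomial.monomial_eq, MvPolynomial.C_1, one_mul,
    Finsupp.prod_fintype _ _ (fun i => pow_zero _)] at h
  simpa using h

lemma residue_X_pow_mul {m n : ℕ} (hn : 0 < n) (b : R) (i : Fin m)
    (f : MvPolynomial (Fin m) R) :
    residue m n b (MvPolynomial.X i ^ n * f) = b * residue m n b f := by
  have : residue m n b ∘ₗ LinearMap.mulLeft R (MvPolynomial.X i ^ n) = b • residue m n b := by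
    refine (MvPolynomial.basisMonomials (Fin m) R).ext fun e => ?_
    rw [MvPolynomial.coe_basisMonomials]
    simp only [LinearMap.comp_apply, LinearMap.mulLeft_apply, LinearMap.smul_apply, smul_eq_mul]
    rw [MvPolynomial.X_pow_eq_monomial, MvPolynomial.monomial_mul, one_mul, residue_monomial,
      residue_monomial, ← Finset.mul_prod_erase _ _ (Finset.mem_univ i),
      ← Finset.mul_prod_erase _ (fun j => powResidue n b (e j)) (Finset.mem_univ i), ← mul_assoc]
    congr 1
    · rw [Finsupp.add_apply, Finsupp.single_eq_same, add_comm, powResidue_add_self hn]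
    · refine Finset.prod_congr rfl fun j hj => ?_
      rw [Finsupp.add_apply, Finsupp.single_eq_of_ne (Finset.ne_of_mem_erase hj), zero_add]
  exact LinearMap.congr_fun this f

/-- The ideal generated by `xᵢ^n - b`. -/
def powIdeal (m n : ℕ) (b : R) : Ideal (MvPolynomial (Fin m) R) :=
  Ideal.span (Set.range fun i => MvPolynomial.X i ^ n - MvPolynomial.C b)

lemma residue_of_mem_powIdeal {m n : ℕ} (hn : 0 < n) (b : R) {f : MvPolynomial (Fin m) R}
    (hf : f ∈ powIdeal m n b) : residue m n b f = 0 := by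
  refine Submodule.span_induction (p := fun x _ => ∀ g, residue m n b (g * x) = 0)
    ?_ ?_ ?_ ?_ hf 1 |> fun h => by simpa using h
  · rintro _ ⟨i, rfl⟩ g
    rw [mul_comm, sub_mul, map_sub, residue_X_pow_mul hn, ← MvPolynomial.smul_eq_C_mul,
      map_smul, smul_eq_mul, sub_self]
  · intro g
    simp
  · intro x y _ _ hx hy g
    rw [mul_add, map_add, hx, hy, add_zero]
  · intro a x _ hx g
    rw [smul_eq_mul, ← mul_assoc, hx]

/-- The generic alternant. -/
abbrev genericAlternant (R : Type*) [CommRing R] {m : ℕ} (e : Fin m → ℕ) :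
    MvPolynomial (Fin m) R :=
  alternant MvPolynomial.X e

/-- Expand both determinants over permutations: the residue is multiplicative over the variables,
and for each fixed first permutation the sum over the second is the same determinant, with the two
signs cancelling. This gives the factor `m!`. -/
lemma residue_alternant_mul_alternant {m : ℕ} (n : ℕ) (b : R) (d e : Fin m → ℕ) :
    residue m n b (genericAlternant R d * genericAlternant R e) =
      m.factorial * Matrix.det (Matrix.of fun i j : Fin m => powResidue n b (d i + e j)) := by
  set J : Matrix (Fin m) (Fin m) R := Matrix.of fun i j : Fin m => powResidue n b (d i + e j)
    with hJ
  have h1 : residue m n b (genericAlternant R d * genericAlternant R e) =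
      ∑ v : Equiv.Perm (Fin m), ((Equiv.Perm.sign v : ℤ) : R) *
        ((Equiv.Perm.sign v : ℤ) : R) * J.det := by
    simp only [genericAlternant, alternant]
    rw [← Matrix.det_transpose, ← Matrix.det_transpose (Matrix.of fun i j => _ ^ e j),
      Matrix.det_apply', Matrix.det_apply', Finset.sum_mul_sum, map_sum]
    refine Finset.sum_congr rfl fun v _ => ?_
    rw [map_sum, mul_assoc, ← Matrix.det_permute, ← Matrix.det_transpose, Matrix.det_apply',
      Finset.mul_sum]
    refine Finset.sum_congr rfl fun w _ => ?_
    have h2 : residue m n b ((((Equiv.Perm.sign v : ℤ) : MvPolynomial (Fin m) R) *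
        ∏ i, (MvPolynomial.X i : MvPolynomial (Fin m) R) ^ d (v i)) *
        (((Equiv.Perm.sign w : ℤ) : MvPolynomial (Fin m) R) *
        ∏ i, (MvPolynomial.X i : MvPolynomial (Fin m) R) ^ e (w i))) =
        ((Equiv.Perm.sign v : ℤ) : R) * (((Equiv.Perm.sign w : ℤ) : R) *
        ∏ i, powResidue n b (d (v i) + e (w i))) := by
      rw [mul_mul_mul_comm, ← Finset.prod_mul_distrib]
      simp only [← pow_add]
      rw [← Int.cast_mul, ← zsmul_eq_mul, map_zsmul, residue_prod_pow, zsmul_eq_mul, Int.cast_mul,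
        mul_assoc]
    exact h2
  rw [h1]
  have h3 : ∀ v : Equiv.Perm (Fin m), ((Equiv.Perm.sign v : ℤ) : R) *
        ((Equiv.Perm.sign v : ℤ) : R) * J.det = J.det := by
    intro v
    rw [← Int.cast_mul, ← Units.val_mul, Int.units_mul_self]
    simp
  simp only [h3]
  simp [Fintype.card_perm]

/-- Modulo the ideal, column `i` of the first alternant is `b` times that of the second. -/
lemma alternant_sub_mem_powIdeal {m : ℕ} (n : ℕ) (b : R) (d e : Fin m → ℕ) (i : Fin m)
    (h : d i = n + e i) (h' : ∀ j, j ≠ i → d j = e j) :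
    genericAlternant R d - MvPolynomial.C b * genericAlternant R e ∈ powIdeal m n b := by
  have hX : ∀ l : Fin m, Ideal.Quotient.mk (powIdeal m n b) (MvPolynomial.X l) ^ n =
      Ideal.Quotient.mk _ (MvPolynomial.C b) := fun l => by
    rw [← map_pow]
    exact Ideal.Quotient.eq.2 (Ideal.subset_span ⟨l, rfl⟩)
  rw [← Ideal.Quotient.eq_zero_iff_mem, map_sub, map_mul, sub_eq_zero, genericAlternant,
    genericAlternant, alternant, alternant, RingHom.map_det, RingHom.map_det]
  set N := (Ideal.Quotient.mk (powIdeal m n b)).mapMatrix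
    (Matrix.of fun i j : Fin m => (MvPolynomial.X i : MvPolynomial (Fin m) R) ^ e j) with hN
  conv_rhs => rw [← Matrix.updateCol_eq_self N i]
  rw [← Matrix.det_updateCol_smul]
  congr 1
  ext l j
  by_cases hj : j = i
  · subst hj
    simp [hN, h, pow_add, hX]
  · simp [hN, hj, h' j hj]

/-- An alternant vanishes modulo `xᵢ^n = b` if two of its exponents differ by `n`. -/
lemma alternant_mem_powIdeal {m : ℕ} (n : ℕ) (b : R) (d : Fin m → ℕ) {i j : Fin m}
    (hij : i ≠ j) (h : d i = n + d j) : genericAlternant R d ∈ powIdeal m n b := by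
  have h1 := alternant_sub_mem_powIdeal n b d (Function.update d i (d j)) i (by simpa using h)
    (fun l hl => by simp [hl])
  have h2 : genericAlternant R (Function.update d i (d j)) = 0 :=
    Matrix.det_zero_of_column_eq hij fun l => by simp [Function.update_of_ne hij.symm]
  rwa [h2, mul_zero, sub_zero] at h1

lemma shifted_strictAnti {m : ℕ} {a : Fin m → ℕ} (ha : Antitone a) :
    StrictAnti (shifted a) := by
  intro i j hij
  have h1 := ha hij.le
  have h2 : (i : ℕ) < j := hij
  have := j.2
  simp only [shifted]
  omega

lemma eq_revPerm_of_strictAnti {m : ℕ} {w : Equiv.Perm (Fin m)} (hw : StrictAnti w) :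
    w = Fin.revPerm := by
  have h : StrictMono (fun i => w (Fin.rev i)) := fun i j hij => hw (Fin.rev_lt_rev.2 hij)
  have := (h.range_inj strictMono_id).1 (by
    rw [Set.range_id, Set.range_eq_univ]
    exact w.surjective.comp Fin.rev_surjective)
  ext i
  have h2 := congrFun this (Fin.rev i)
  simp only [Fin.rev_rev, id] at h2
  rw [h2, Fin.revPerm_apply]

/-- The complement of a partition in the rectangle. -/
def RectPartition.dual {m k : ℕ} (a : RectPartition m k) : RectPartition m k :=
  ⟨fun i => k - a.1 (Fin.rev i), fun i j hij => by
    have := a.2.1 (Fin.rev_le_rev.2 hij)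
    dsimp only
    omega, fun i => Nat.sub_le _ _⟩

lemma RectPartition.dual_dual {m k : ℕ} (a : RectPartition m k) : a.dual.dual = a := by
  ext i
  have := a.2.2 i
  simp only [dual, Fin.rev_rev]
  omega

lemma det_powResidue_eq {m k : ℕ} (hm : 0 < m) (b : R) (u v : RectPartition m k) :
    Matrix.det (Matrix.of fun i j : Fin m =>
      powResidue (m + k) b (shifted u.1 i + shifted v.1 j)) =
      if v = u.dual then ((Equiv.Perm.sign (Fin.revPerm : Equiv.Perm (Fin m)) : ℤ) : R) else 0 := by
  have hJ : ∀ i j : Fin m, powResidue (m + k) b (shifted u.1 i + shifted v.1 j) =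
      if shifted u.1 i + shifted v.1 j = m + k - 1 then 1 else 0 := by
    intro i j
    -- Both shifted exponents are at most `n - 1`, so their sum is at most `2n - 2` and no power of
    -- `b` can enter; this is why the pairing has no `q`-terms.
    apply powResidue_of_lt (by omega)
    have h1 := u.2.2 i
    have h2 := v.2.2 j
    simp only [shifted]
    omega
  simp only [hJ]
  split_ifs with h
  · have h1 := Matrix.det_permute (Fin.revPerm : Equiv.Perm (Fin m)) (1 : Matrix _ _ R)
    rw [Matrix.det_one, mul_one] at h1
    rw [← h1]
    congr 1
    ext i j
    have hst := (shifted_strictAnti u.2.1).injective.eq_iff (a := i) (b := Fin.rev j)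
    have h1 := u.2.2 (Fin.rev j)
    have h2 := u.2.2 i
    have hi := i.2
    have hj := j.2
    simp only [Matrix.of_apply, Matrix.submatrix_apply, id, Matrix.one_apply, Fin.revPerm_apply]
    congr 1
    rw [Fin.rev_eq_iff, ← hst, h, eq_iff_iff]
    simp only [shifted, RectPartition.dual, Fin.val_rev]
    omega
  · rw [Matrix.det_apply']
    refine Finset.sum_eq_zero fun w _ => ?_
    by_contra hne
    have hw : ∀ j, shifted u.1 (w j) + shifted v.1 j = m + k - 1 := by
      intro j
      by_contra hj
      apply hne
      rw [Finset.prod_eq_zero (Finset.mem_univ j) (by simp [hj]), mul_zero]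
    -- A nonzero term forces `shifted u ∘ w` to increase while `shifted u` decreases, so `w` is the
    -- order reversal and `v` is the complement of `u`.
    have hanti : StrictAnti w := by
      intro i j hij
      have h1 := shifted_strictAnti v.2.1 hij
      rw [← (shifted_strictAnti u.2.1).lt_iff_gt]
      have := hw i
      have := hw j
      omega
    apply h
    ext j
    have h1 := hw j
    rw [eq_revPerm_of_strictAnti hanti, Fin.revPerm_apply] at h1
    have h2 := u.2.2 (Fin.rev j)
    have h3 := v.2.2 j
    have hj := j.2
    simp only [shifted, RectPartition.dual, Fin.val_rev] at h1 ⊢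
    omega

end Residue

/-! ### The residue functional on `QH_α` and duality -/

section Trace

open Polynomial in
/-- The map sending `c_i` to the elementary symmetric polynomials. -/
def toSymm (m : ℕ) : Polynomial (S m) →+* MvPolynomial (Fin m) ℚ[X] :=
  Polynomial.eval₂RingHom
    (MvPolynomial.eval₂Hom (MvPolynomial.C.comp Polynomial.C)
      fun i : Fin m => elemSymm MvPolynomial.X ((i : ℕ) + 1))
    (MvPolynomial.C Polynomial.X)

lemma toSymm_C_c (m p : ℕ) (hp : p ≠ 0) :
    toSymm m (Polynomial.C (c m p)) = elemSymm MvPolynomial.X p := by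
  unfold c
  split_ifs with h
  · simp [toSymm, Nat.sub_add_cancel h.1]
  · rw [elemSymm_eq_zero _ (by omega)]
    simp

lemma toSymm_C_sigma (m p : ℕ) : toSymm m (Polynomial.C (sigma m p)) =
    Delta (fun _ : Fin p => 1) (elemSymm MvPolynomial.X) := by
  have h := map_Delta ((toSymm m).comp Polynomial.C) (fun _ : Fin p => 1) (c m)
  rw [sigma]
  refine h.trans (Delta_congr _ fun p hp => toSymm_C_c m p hp)

lemma toSymm_C_Delta_sigma_mul {m : ℕ} (a : Fin m → ℕ) :
    toSymm m (Polynomial.C (Delta a (sigma m))) * genericAlternant _ (shifted 0) =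
      genericAlternant _ (shifted a) := by
  have h := map_Delta ((toSymm m).comp Polynomial.C) a (sigma m)
  rw [RingHom.comp_apply] at h
  rw [h, genericAlternant, genericAlternant, ← Delta_mul_alternant _ a]
  congr 2
  ext1 p
  exact toSymm_C_sigma m p

lemma toSymm_C_sigma_mul {m : ℕ} (hm : 0 < m) {p : ℕ} (hp : p ≠ 0) :
    toSymm m (Polynomial.C (sigma m p)) * genericAlternant _ (shifted 0) =
      genericAlternant _ (shifted fun i : Fin m => if (i : ℕ) = 0 then p else 0) := by
  rw [← toSymm_C_Delta_sigma_mul (fun i : Fin m => if (i : ℕ) = 0 then p else 0)]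
  obtain ⟨l, rfl⟩ := Nat.exists_eq_succ_of_ne_zero hm.ne'
  have := Delta_single (l := l) p (sigma (l + 1))
  rw [extendSeq_natCast _ hp] at this
  rw [← this]
  simp only [Fin.ext_iff, Fin.val_zero, Nat.succ_eq_add_one]

/-- The value of `xᵢ^n` in the model of `QH_α`. -/
def rootPower (m : ℕ) (α : ℚ) : Polynomial ℚ := (-1) ^ (m + 1) * Polynomial.C α * Polynomial.X

/-- Makes the residue descend to the quotient. Multiplying by the Vandermonde determinant turns each
relation into alternants, which are reduced by comparing exponents modulo `n`. -/
lemma toSymm_mul_mem_powIdeal {m k : ℕ} (hm : 0 < m) (α : ℚ) {f : Polynomial (S m)}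
    (hf : f ∈ relations m k α) :
    toSymm m f * genericAlternant _ (shifted 0) ∈ powIdeal m (m + k) (rootPower m α) := by
  refine Submodule.span_induction (p := fun f _ =>
    toSymm m f * genericAlternant _ (shifted 0) ∈ powIdeal m (m + k) (rootPower m α))
    ?_ ?_ ?_ ?_ hf
  · rintro f (⟨p, hp1, hp2, rfl⟩ | rfl)
    · rw [toSymm_C_sigma_mul hm (by omega)]
      -- The leading exponent `p + m - 1` exceeds by `n` the exponent `p - k - 1`, which stands in
      -- column `m + k - p`.
      refine alternant_mem_powIdeal _ _ _ (i := ⟨0, hm⟩) (j := ⟨m + k - p, by omega⟩) ?_ ?_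
      · simp only [ne_eq, Fin.mk.injEq]
        omega
      · simp only [shifted, if_true]
        rw [if_neg (by omega)]
        omega
    · rw [map_add, add_mul, toSymm_C_sigma_mul hm (by omega)]
      -- For `p = n` only the leading exponent is raised, by exactly `n`; the sign in `rootPower` is
      -- the one that cancels the term `(-1)^m α q`.
      have h := alternant_sub_mem_powIdeal (m + k) (rootPower m α)
        (shifted fun i : Fin m => if (i : ℕ) = 0 then m + k else 0) (shifted 0) ⟨0, hm⟩
        (by simp only [shifted, if_true, Pi.zero_apply]; omega)
        (fun j hj => by
          have : (j : ℕ) ≠ 0 := fun h => hj (Fin.ext h)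
          simp [shifted, this])
      convert h using 1
      rw [sub_eq_add_neg, ← neg_mul]
      congr 2
      rw [map_mul, map_mul, map_pow, map_neg, map_one]
      simp [toSymm, rootPower, pow_succ]
  · simp
  · intro f g _ _ hf hg
    rw [map_add, add_mul]
    exact Ideal.add_mem _ hf hg
  · intro g f _ hf
    rw [smul_eq_mul, map_mul, mul_assoc]
    exact Ideal.mul_mem_left _ _ hf

/-- The residue functional on `S[q]`. -/
def polyTrace (m k : ℕ) (α : ℚ) (f : Polynomial (S m)) : Polynomial ℚ :=
  residue m (m + k) (rootPower m α)
    (toSymm m f * genericAlternant _ (shifted 0) * genericAlternant _ (shifted 0))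

lemma polyTrace_add (m k : ℕ) (α : ℚ) (f g : Polynomial (S m)) :
    polyTrace m k α (f + g) = polyTrace m k α f + polyTrace m k α g := by
  simp only [polyTrace, map_add, add_mul]

lemma polyTrace_map_mul (m k : ℕ) (α : ℚ) (r : Polynomial ℚ) (f : Polynomial (S m)) :
    polyTrace m k α (Polynomial.map MvPolynomial.C r * f) = r * polyTrace m k α f := by
  have h : toSymm m (Polynomial.map MvPolynomial.C r) = MvPolynomial.C r := by
    have : ((toSymm m).comp (Polynomial.mapRingHom MvPolynomial.C)) = MvPolynomial.C := by
      ext <;> simp [toSymm]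
    exact RingHom.congr_fun this r
  simp only [polyTrace, map_mul, h, mul_assoc]
  rw [← MvPolynomial.smul_eq_C_mul, map_smul, smul_eq_mul]

lemma polyTrace_eq_of_mk_eq {m k : ℕ} (hm : 0 < m) (α : ℚ) {f g : Polynomial (S m)}
    (h : QH.mk m k α f = QH.mk m k α g) : polyTrace m k α f = polyTrace m k α g := by
  have hmem : f - g ∈ relations m k α := Ideal.Quotient.eq.1 h
  have h0 : polyTrace m k α (f - g) = 0 :=
    residue_of_mem_powIdeal (by omega) _ (Ideal.mul_mem_right _ _ (toSymm_mul_mem_powIdeal hm α hmem))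
  rw [← sub_add_cancel f g, polyTrace_add, h0, zero_add]

lemma QH.mk_surjective (m k : ℕ) (α : ℚ) : Function.Surjective (QH.mk m k α) :=
  Ideal.Quotient.mk_surjective

lemma QH.smul_mk {m k : ℕ} {α : ℚ} (r : Polynomial ℚ) (f : Polynomial (S m)) :
    r • QH.mk m k α f = QH.mk m k α (Polynomial.map MvPolynomial.C r * f) := by
  rw [Algebra.smul_def, map_mul]
  rfl

/-- There is a `ℚ[q]`-linear functional for which the classes `σ_u` are dual to each other. -/
lemma exists_trace {m k : ℕ} (hm : 0 < m) (α : ℚ) :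
    ∃ (E : QH m k α →ₗ[Polynomial ℚ] Polynomial ℚ) (C : ℚ), C ≠ 0 ∧
      ∀ u v : RectPartition m k, E (QH.sigma α u * QH.sigma α v) =
        if v = u.dual then Polynomial.C C else 0 := by
  have hs := QH.mk_surjective m k α
  -- An arbitrary set-theoretic section; linearity of `E` follows because `polyTrace` depends only
  -- on the class in the quotient.
  set g := Function.surjInv hs with hg
  have hgs : ∀ x, QH.mk m k α (g x) = x := Function.surjInv_eq hs
  let E : QH m k α →ₗ[Polynomial ℚ] Polynomial ℚ :=
    { toFun := fun x => polyTrace m k α (g x)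
      map_add' := fun x y => by
        rw [← polyTrace_add]
        apply polyTrace_eq_of_mk_eq hm
        rw [map_add, hgs, hgs, hgs]
      map_smul' := fun r x => by
        rw [RingHom.id_apply, smul_eq_mul, ← polyTrace_map_mul]
        apply polyTrace_eq_of_mk_eq hm
        rw [← QH.smul_mk, hgs, hgs] }
  have hE : ∀ f, E (QH.mk m k α f) = polyTrace m k α f := fun f =>
    polyTrace_eq_of_mk_eq hm α (hgs _)
  refine ⟨E, m.factorial * ((Equiv.Perm.sign (Fin.revPerm : Equiv.Perm (Fin m)) : ℤ) : ℚ),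
    mul_ne_zero (by exact_mod_cast m.factorial_ne_zero) (by simp), fun u v => ?_⟩
  rw [QH.sigma, QH.sigma, ← map_mul, hE, polyTrace, map_mul (toSymm m), mul_assoc, mul_mul_mul_comm,
    sigmaPartition, sigmaPartition, toSymm_C_Delta_sigma_mul, toSymm_C_Delta_sigma_mul,
    residue_alternant_mul_alternant, det_powResidue_eq hm]
  split_ifs <;> simp

end Trace

/-! ### Degrees detected as eigenvalues of the scaling by powers of `2` -/

section Scaling

lemma map_extendSeq_of_scaling {R : Type*} [CommRing R] (F : R →+* R) (t : R) (h : ℕ → R)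
    (hF : ∀ p, p ≠ 0 → F (h p) = t ^ p * h p) (i : ℤ) :
    F (extendSeq h i) = t ^ i.toNat * extendSeq h i := by
  unfold extendSeq
  split_ifs with h1 h2
  · simp
  · simp [h2]
  · exact hF _ (by omega)

/-- Scaling the entries amounts to conjugating by `diag(t^i)` and multiplying row `i` by `t^(a i)`;
the domain hypothesis allows the powers of `t` to be cancelled. -/
lemma map_Delta_of_scaling {R : Type*} [CommRing R] [IsDomain R] (F : R →+* R) {t : R}
    (ht : t ≠ 0) (h : ℕ → R) (hF : ∀ p, p ≠ 0 → F (h p) = t ^ p * h p) {l : ℕ}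
    (a : Fin l → ℕ) : F (Delta a h) = t ^ (∑ i, a i) * Delta a h := by
  set M : Matrix (Fin l) (Fin l) R :=
    Matrix.of fun i j : Fin l => extendSeq h ((a i : ℤ) + (j : ℤ) - (i : ℤ)) with hM
  have h1 : (∏ i : Fin l, t ^ (i : ℕ)) * F M.det =
      (∏ i, t ^ a i) * ((∏ j : Fin l, t ^ (j : ℕ)) * M.det) := by
    rw [RingHom.map_det, ← Matrix.det_mul_column, ← Matrix.det_mul_row, ← Matrix.det_mul_column]
    congr 1
    ext i j
    simp only [hM, Matrix.of_apply, RingHom.mapMatrix_apply, Matrix.map_apply]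
    rw [map_extendSeq_of_scaling F t h hF]
    by_cases hneg : (a i : ℤ) + (j : ℤ) - (i : ℤ) < 0
    · simp [extendSeq_of_neg h hneg]
    · rw [← mul_assoc, ← mul_assoc, ← pow_add, ← pow_add]
      congr 2
      omega
  have hne : (∏ i : Fin l, t ^ (i : ℕ)) ≠ 0 := Finset.prod_ne_zero_iff.2 fun i _ => pow_ne_zero _ ht
  rw [Delta, ← Finset.prod_pow_eq_pow_sum]
  apply mul_left_cancel₀ hne
  rw [h1]
  ring

/-- The substitution `c_p ↦ 2^p c_p` of `S`. -/
def scaleS (m : ℕ) : S m →ₐ[ℚ] S m :=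
  MvPolynomial.aeval fun i : Fin m => (2 : S m) ^ ((i : ℕ) + 1) * MvPolynomial.X i

lemma scaleS_c (m p : ℕ) : scaleS m (c m p) = 2 ^ p * c m p := by
  unfold c
  split_ifs with h
  · simp [scaleS, Nat.sub_add_cancel h.1]
  · simp

lemma scaleS_sigma (m p : ℕ) : scaleS m (sigma m p) = 2 ^ p * sigma m p := by
  have h := map_Delta_of_scaling (scaleS m : S m →+* S m) (t := 2) two_ne_zero (c m)
    (fun p _ => scaleS_c m p) (fun _ : Fin p => 1)
  simpa [sigma] using h

lemma scaleS_of_isWeightedHomogeneous {m : ℕ} {p : S m} {e : ℕ}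
    (hp : MvPolynomial.IsWeightedHomogeneous (fun i : Fin m => (i : ℕ) + 1) p e) :
    scaleS m p = 2 ^ e * p := by
  rw [scaleS, MvPolynomial.aeval_def, MvPolynomial.eval₂_eq']
  conv_rhs => rw [MvPolynomial.as_sum p, Finset.mul_sum]
  refine Finset.sum_congr rfl fun d hd => ?_
  have hw := hp (MvPolynomial.mem_support_iff.1 hd)
  rw [Finsupp.weight_apply, Finsupp.sum_fintype _ _ (by simp)] at hw
  rw [MvPolynomial.monomial_eq, Finsupp.prod_fintype _ _ (by simp), ← hw,
    ← Finset.prod_pow_eq_pow_sum, MvPolynomial.algebraMap_eq, mul_left_comm,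
    ← Finset.prod_mul_distrib]
  congr 1
  refine Finset.prod_congr rfl fun i _ => ?_
  rw [mul_pow, ← pow_mul, smul_eq_mul, mul_comm (d i)]

/-- The substitution `c_p ↦ 2^p c_p`, `q ↦ 2^n q` of `S[q]`. -/
def scalePoly (m k : ℕ) : Polynomial (S m) →+* Polynomial (S m) :=
  Polynomial.eval₂RingHom (Polynomial.C.comp (scaleS m : S m →+* S m))
    ((2 : Polynomial (S m)) ^ (m + k) * Polynomial.X)

lemma scalePoly_C {m k : ℕ} (f : S m) :
    scalePoly m k (Polynomial.C f) = Polynomial.C (scaleS m f) := by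
  simp [scalePoly]

lemma scalePoly_X {m k : ℕ} : scalePoly m k Polynomial.X = 2 ^ (m + k) * Polynomial.X := by
  simp [scalePoly]

lemma scalePoly_of_isHomogeneousPoly {m k : ℕ} {f : Polynomial (S m)} {D : ℕ}
    (hf : IsHomogeneousPoly m k f D) : scalePoly m k f = 2 ^ D * f := by
  conv_rhs => rw [f.as_sum_support_C_mul_X_pow, Finset.mul_sum]
  conv_lhs => rw [f.as_sum_support_C_mul_X_pow, map_sum]
  refine Finset.sum_congr rfl fun d hd => ?_
  obtain ⟨e, rfl, he⟩ := hf d (Polynomial.mem_support_iff.1 hd)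
  rw [map_mul, map_pow, scalePoly_C, scalePoly_X, scaleS_of_isWeightedHomogeneous he, map_mul,
    map_pow, map_ofNat, mul_pow, pow_add 2 e, pow_mul]
  ring

lemma relations_le_ker {m k : ℕ} (α : ℚ) :
    relations m k α ≤ RingHom.ker ((QH.mk m k α).comp (scalePoly m k)) := by
  refine Ideal.span_le.2 ?_
  have hker : ∀ f ∈ relations m k α, QH.mk m k α f = 0 := fun f hf =>
    Ideal.Quotient.eq_zero_iff_mem.2 hf
  rintro f (⟨p, hp1, hp2, rfl⟩ | rfl)
  · rw [SetLike.mem_coe, RingHom.mem_ker, RingHom.comp_apply, scalePoly_C, scaleS_sigma, map_mul,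
      map_mul, hker (Polynomial.C (sigma m p)), mul_zero]
    exact Ideal.subset_span (Or.inl ⟨p, hp1, hp2, rfl⟩)
  · have h1 := hker _ (Ideal.subset_span (Or.inr rfl))
    rw [SetLike.mem_coe, RingHom.mem_ker, RingHom.comp_apply, map_add, map_mul, map_mul, map_pow,
      map_neg, map_one, scalePoly_C, scalePoly_C, scalePoly_X, scaleS_sigma]
    have : (scaleS m) (MvPolynomial.C α) = MvPolynomial.C α := by simp [scaleS]
    rw [this, map_mul, map_pow, map_ofNat, ← mul_zero (QH.mk m k α (2 ^ (m + k))), ← h1,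
      ← map_mul]
    congr 1
    ring

/-- The scaling endomorphism of `QH_α`. -/
def QH.scale (m k : ℕ) (α : ℚ) : QH m k α →+* QH m k α :=
  Ideal.Quotient.lift (relations m k α) ((QH.mk m k α).comp (scalePoly m k))
    fun _ hf => relations_le_ker α hf

lemma QH.scale_mk {m k : ℕ} {α : ℚ} (f : Polynomial (S m)) :
    QH.scale m k α (QH.mk m k α f) = QH.mk m k α (scalePoly m k f) := rfl

lemma map_C_two_pow (m D : ℕ) :
    Polynomial.map (MvPolynomial.C (σ := Fin m)) (Polynomial.C ((2 : ℚ) ^ D)) =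
      Polynomial.C (2 ^ D) := by
  rw [Polynomial.map_C, map_pow, map_ofNat]

lemma QH.scale_of_isHomogeneous {m k : ℕ} {α : ℚ} {x : QH m k α} {D : ℕ}
    (hx : x.IsHomogeneous D) :
    QH.scale m k α x = Polynomial.C ((2 : ℚ) ^ D) • x := by
  obtain ⟨f, hf, rfl⟩ := hx
  rw [QH.scale_mk, scalePoly_of_isHomogeneousPoly hf, QH.smul_mk,
    map_C_two_pow, map_pow, map_ofNat]

lemma QH.scale_smul {m k : ℕ} {α : ℚ} (r : Polynomial ℚ) (x : QH m k α) :
    QH.scale m k α (r • x) =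
      r.comp (Polynomial.C ((2 : ℚ) ^ (m + k)) * Polynomial.X) • QH.scale m k α x := by
  obtain ⟨f, rfl⟩ := QH.mk_surjective m k α x
  rw [QH.smul_mk, QH.scale_mk, map_mul, QH.scale_mk, QH.smul_mk]
  congr 2
  have : (scalePoly m k).comp (Polynomial.mapRingHom MvPolynomial.C) =
      (Polynomial.mapRingHom MvPolynomial.C).comp
        (Polynomial.compRingHom (Polynomial.C ((2 : ℚ) ^ (m + k)) * Polynomial.X)) := by
    refine Polynomial.ringHom_ext (fun a => ?_) ?_
    · simp [scalePoly_C, scaleS]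
    · simp only [RingHom.comp_apply, Polynomial.coe_mapRingHom, Polynomial.map_X, scalePoly_X,
        Polynomial.coe_compRingHom, Polynomial.X_comp, Polynomial.map_mul, map_pow, map_ofNat,
        Polynomial.map_pow, Polynomial.map_ofNat]
  exact RingHom.congr_fun this r

lemma QH.scale_sigma {m k : ℕ} (α : ℚ) (a : RectPartition m k) :
    QH.scale m k α (QH.sigma α a) = Polynomial.C ((2 : ℚ) ^ a.weight) • QH.sigma α a := by
  rw [QH.sigma, QH.scale_mk, scalePoly_C, QH.smul_mk, sigmaPartition]
  have h := map_Delta_of_scaling (scaleS m : S m →+* S m) (t := 2) two_ne_zero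
    (QuantumGrassmannian.sigma m)
    (fun p _ => scaleS_sigma m p) a.1
  have h' : scaleS m (Delta a.1 (QuantumGrassmannian.sigma m)) =
      2 ^ a.weight * Delta a.1 (QuantumGrassmannian.sigma m) := h
  rw [h', map_C_two_pow, map_mul]

/-- The coordinates of an eigenvector of the scaling in a homogeneous basis are monomials. -/
lemma weight_add_of_coeff_repr_ne_zero {m k : ℕ} {α : ℚ}
    (τ : Module.Basis (RectPartition m k) (Polynomial ℚ) (QH m k α))
    (hdeg : ∀ a, (τ a).IsHomogeneous a.weight) {x : QH m k α} {D : ℕ}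
    (hx : QH.scale m k α x = Polynomial.C ((2 : ℚ) ^ D) • x) {v : RectPartition m k} {d : ℕ}
    (h : (τ.repr x v).coeff d ≠ 0) : v.weight + (m + k) * d = D := by
  classical
  have h1 : QH.scale m k α x = ∑ u ∈ (τ.repr x).support,
      ((τ.repr x u).comp (Polynomial.C ((2 : ℚ) ^ (m + k)) * Polynomial.X) *
        Polynomial.C ((2 : ℚ) ^ u.weight)) • τ u := by
    conv_lhs => rw [← τ.linearCombination_repr x, Finsupp.linearCombination_apply, Finsupp.sum,
      map_sum]
    refine Finset.sum_congr rfl fun u _ => ?_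
    rw [QH.scale_smul, QH.scale_of_isHomogeneous (hdeg u), smul_smul]
  have hv : v ∈ (τ.repr x).support := by
    rw [Finsupp.mem_support_iff]
    intro h0
    simp [h0] at h
  have h2 := congrArg (fun y => (τ.repr y v).coeff d) (h1.symm.trans hx)
  simp only [map_sum, map_smul, Finsupp.coe_finsetSum, Finset.sum_apply, Finsupp.smul_apply,
    Module.Basis.repr_self, smul_eq_mul] at h2
  rw [Finset.sum_eq_single v (fun u _ hu => by simp [hu])
    (fun h => absurd hv h), Finsupp.single_eq_same, mul_one, Polynomial.coeff_mul_C,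
    Polynomial.comp_C_mul_X_coeff, Polynomial.coeff_C_mul, mul_assoc, mul_comm] at h2
  -- Comparison of the coefficients of `q^d τ_v` leaves `2^(n d) 2^|v| = 2^D`, and powers of `2` in
  -- `ℚ` determine their exponents.
  have h3 := mul_right_cancel₀ h h2
  rw [← pow_mul, ← pow_add] at h3
  have := pow_right_injective₀ (a := (2 : ℚ)) (by norm_num) (by norm_num) h3
  omega

end Scaling

/-! ### Partitions in the rectangle and complementation -/

section Rectangle

variable {m k : ℕ}

instance : Finite (RectPartition m k) :=
  Finite.of_injective
    (fun (u : RectPartition m k) (i : Fin m) => (⟨u.1 i, Nat.lt_succ_of_le (u.2.2 i)⟩ : Fin (k + 1)))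
    fun _ _ h => Subtype.ext <| funext fun i => congrArg Fin.val (congrFun h i)

instance : Fintype (RectPartition m k) := Fintype.ofFinite _

/-- The empty partition. -/
def RectPartition.empty (m k : ℕ) : RectPartition m k :=
  ⟨fun _ => 0, antitone_const, fun _ => Nat.zero_le k⟩

lemma RectPartition.eq_dual_iff {u v : RectPartition m k} : v = u.dual ↔ u = v.dual :=
  ⟨fun h => by rw [h, dual_dual], fun h => by rw [h, dual_dual]⟩

/-- Complementation as a permutation of the set of partitions. -/
def RectPartition.dualEquiv (m k : ℕ) : RectPartition m k ≃ RectPartition m k :=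
  ⟨dual, dual, dual_dual, dual_dual⟩

lemma RectPartition.weight_le_weight_dual_empty (u : RectPartition m k) :
    u.weight ≤ (empty m k).dual.weight :=
  Finset.sum_le_sum fun i _ => by simpa [dual, empty] using u.2.2 i

/-- The partition with the parts `e i`, in some order. -/
lemma RectPartition.exists_prod_eq {M : Type*} [CommMonoid M] (g : ℕ → M) (e : Fin m → ℕ)
    (he : ∀ i, e i ≤ k) : ∃ u : RectPartition m k, ∏ i, g (e i) = ∏ i, g (u.1 i) := by
  refine ⟨⟨fun i => e (Tuple.sort e (Fin.rev i)), fun i j hij => ?_, fun i => he _⟩, ?_⟩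
  · exact Tuple.monotone_sort e (Fin.rev_le_rev.2 hij)
  · exact (Equiv.prod_comp (Fin.revPerm.trans (Tuple.sort e)) fun i => g (e i)).symm

end Rectangle

/-! ### Special classes and the Jacobi–Trudi expansion -/

section Special

variable {m k : ℕ} {α : ℚ}

/-- The class of `σ_p`, for an integer `p`. -/
def specialClass (m k : ℕ) (α : ℚ) (p : ℤ) : QH m k α :=
  QH.mk m k α (Polynomial.C (extendSeq (sigma m) p))

lemma specialClass_of_neg {p : ℤ} (hp : p < 0) : specialClass m k α p = 0 := by
  rw [specialClass, extendSeq_of_neg _ hp, map_zero, map_zero]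

lemma specialClass_zero : specialClass m k α 0 = 1 := by
  rw [specialClass, extendSeq_zero, map_one, map_one]

lemma specialClass_of_lt {p : ℕ} (h1 : k < p) (h2 : p < m + k) : specialClass m k α p = 0 := by
  rw [specialClass, extendSeq_natCast _ (by omega)]
  exact Ideal.Quotient.eq_zero_iff_mem.2 (Ideal.subset_span (Or.inl ⟨p, h1, h2, rfl⟩))

/-- The product of the special classes indexed by the parts of `u`. -/
def specialProd (α : ℚ) (u : RectPartition m k) : QH m k α :=
  ∏ i, specialClass m k α (u.1 i : ℕ)

lemma sigma_eq_det (u : RectPartition m k) : QH.sigma α u =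
    Matrix.det (Matrix.of fun i j : Fin m =>
      specialClass m k α ((u.1 i : ℤ) + (j : ℤ) - (i : ℤ))) := by
  have : QH.sigma α u = ((QH.mk m k α).comp Polynomial.C) (sigmaPartition u) := rfl
  rw [this, sigmaPartition, Delta, RingHom.map_det]
  rfl

lemma sigma_empty : QH.sigma α (RectPartition.empty m k) = 1 := by
  have : sigmaPartition (RectPartition.empty m k) = 1 := Delta_zero _
  rw [QH.sigma, this, map_one, map_one]

lemma specialClass_eq_sigma (hm : 0 < m) {p : ℕ} (hp : p ≤ k) :
    ∃ u : RectPartition m k, u.weight = p ∧ specialClass m k α p = QH.sigma α u := by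
  obtain ⟨l, rfl⟩ := Nat.exists_eq_succ_of_ne_zero hm.ne'
  refine ⟨⟨fun i => if i = 0 then p else 0, fun i j hij => ?_, fun i => ?_⟩, ?_, ?_⟩
  · dsimp only
    split_ifs with h1 h2
    · rfl
    · subst h1
      exact absurd (Fin.le_zero_iff.1 hij) h2
    · exact Nat.zero_le _
    · rfl
  · dsimp only
    split_ifs
    · exact hp
    · exact Nat.zero_le _
  · simp [RectPartition.weight]
  · rw [QH.sigma, sigmaPartition, Delta_single, specialClass]

/-- The classes `σ_u` are rational combinations of products of special classes. -/
lemma exists_sigma_eq_sum_specialProd (α : ℚ) (u : RectPartition m k) :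
    ∃ c : RectPartition m k → ℚ,
      QH.sigma α u = ∑ v, Polynomial.C (c v) • specialProd α v := by
  classical
  have key : ∀ w : Equiv.Perm (Fin m), ∃ c : RectPartition m k → ℚ,
      ∏ i, specialClass m k α ((u.1 (w i) : ℤ) + (i : ℤ) - (w i : ℤ)) =
        ∑ v, Polynomial.C (c v) • specialProd α v := by
    intro w
    -- Indices in the Jacobi–Trudi determinant are at most `k + m - 1 = n - 1`. Those above `k` give
    -- zero by the relations without `q`, and `σ_n` never occurs, so the coefficients are rational
    -- numbers.
    by_cases h : ∀ i, 0 ≤ (u.1 (w i) : ℤ) + (i : ℤ) - (w i : ℤ) ∧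
        (u.1 (w i) : ℤ) + (i : ℤ) - (w i : ℤ) ≤ k
    · obtain ⟨v, hv⟩ := RectPartition.exists_prod_eq (k := k)
        (fun p : ℕ => specialClass m k α p)
        (fun i => ((u.1 (w i) : ℤ) + (i : ℤ) - (w i : ℤ)).toNat)
        (fun i => by have := h i; omega)
      refine ⟨Pi.single v 1, ?_⟩
      rw [Finset.sum_eq_single v (fun v' _ hv' => by simp [hv']) (by simp), Pi.single_eq_same,
        Polynomial.C_1, one_smul, specialProd, ← hv]
      refine Finset.prod_congr rfl fun i _ => ?_
      rw [Int.toNat_of_nonneg (h i).1]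
    · refine ⟨0, ?_⟩
      push Not at h
      obtain ⟨i, hi⟩ := h
      rw [Finset.prod_eq_zero (Finset.mem_univ i)]
      · simp
      · by_cases h0 : 0 ≤ (u.1 (w i) : ℤ) + (i : ℤ) - (w i : ℤ)
        · obtain ⟨p, hp⟩ := Int.eq_ofNat_of_zero_le h0
          have h1 := hi h0
          have h2 := u.2.2 (w i)
          have h3 := i.2
          rw [hp]
          exact specialClass_of_lt (by omega) (by omega)
        · exact specialClass_of_neg (by omega)
  choose c hc using key
  refine ⟨fun v => ∑ w, ((Equiv.Perm.sign w : ℤ) : ℚ) * c w v, ?_⟩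
  rw [sigma_eq_det, Matrix.det_apply']
  simp only [Matrix.of_apply, hc, map_sum, Finset.sum_smul]
  rw [Finset.sum_comm]
  refine Finset.sum_congr rfl fun w _ => ?_
  rw [Finset.mul_sum]
  refine Finset.sum_congr rfl fun v _ => ?_
  rw [map_mul, mul_smul, map_intCast, Int.cast_smul_eq_zsmul, zsmul_eq_mul]

end Special

/-! ### Coordinates in `τ`, positivity and the squeeze -/

section Basis

variable {m k : ℕ} {α : ℚ} (τ : Module.Basis (RectPartition m k) (Polynomial ℚ) (QH m k α))

lemma coeff_zero_repr_sigma
    (hdeform : ∀ a, τ a - QH.sigma α a ∈ Ideal.span {QH.q m k α}) (u v : RectPartition m k) :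
    (τ.repr (QH.sigma α u) v).coeff 0 = if u = v then 1 else 0 := by
  obtain ⟨y, hy⟩ := Ideal.mem_span_singleton.1 (hdeform u)
  have hq : QH.q m k α * y = (Polynomial.X : Polynomial ℚ) • y := by
    rw [Algebra.smul_def]
    congr 1
    change _ = QH.mk m k α (Polynomial.map MvPolynomial.C Polynomial.X)
    rw [Polynomial.map_X, QH.q]
  have h : QH.sigma α u = τ u - (Polynomial.X : Polynomial ℚ) • y := by
    rw [← hq, ← hy, sub_sub_cancel]
  rw [h, map_sub, map_smul, τ.repr_self, Finsupp.sub_apply, Finsupp.smul_apply, smul_eq_mul,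
    Polynomial.coeff_sub, Polynomial.mul_coeff_zero, Polynomial.coeff_X_zero, zero_mul, sub_zero,
    Finsupp.single_apply]
  split_ifs <;> simp

lemma eq_sigma_of_coeff_eq_zero
    (hdeform : ∀ a, τ a - QH.sigma α a ∈ Ideal.span {QH.q m k α}) (u : RectPartition m k)
    (h : ∀ v d, 0 < d → (τ.repr (QH.sigma α u) v).coeff d = 0) : τ u = QH.sigma α u := by
  apply τ.repr.injective
  ext v d
  rcases Nat.eq_zero_or_pos d with rfl | hd
  · rw [coeff_zero_repr_sigma τ hdeform, τ.repr_self, Finsupp.single_apply]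
    split_ifs <;> simp
  · rw [h v d hd, τ.repr_self, Finsupp.single_apply]
    split_ifs
    · simp [Polynomial.coeff_one, hd.ne']
    · simp

lemma weight_add_of_coeff_repr_sigma_ne_zero (hdeg : ∀ a, (τ a).IsHomogeneous a.weight)
    {u v : RectPartition m k} {d : ℕ} (h : (τ.repr (QH.sigma α u) v).coeff d ≠ 0) :
    v.weight + (m + k) * d = u.weight :=
  weight_add_of_coeff_repr_ne_zero τ hdeg (QH.scale_sigma α u) h

/-- A correction term would carry a positive power of `q`, hence have degree at least `n`. -/
lemma eq_sigma_of_weight_lt (hdeg : ∀ a, (τ a).IsHomogeneous a.weight)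
    (hdeform : ∀ a, τ a - QH.sigma α a ∈ Ideal.span {QH.q m k α}) (u : RectPartition m k)
    (hu : u.weight < m + k) : τ u = QH.sigma α u := by
  refine eq_sigma_of_coeff_eq_zero τ hdeform u fun v d hd => ?_
  by_contra h
  have h1 := weight_add_of_coeff_repr_sigma_ne_zero τ hdeg h
  have h2 := Nat.le_mul_of_pos_right (m + k) hd
  omega

/-- The full rectangle has the largest weight, so a term `q^d τ_P` with `d > 0` has degree larger
than that of any `σ_u`. -/
lemma repr_sigma_dual_empty (hm : 0 < m) (hdeg : ∀ a, (τ a).IsHomogeneous a.weight)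
    (hdeform : ∀ a, τ a - QH.sigma α a ∈ Ideal.span {QH.q m k α}) (u : RectPartition m k) :
    τ.repr (QH.sigma α u) (RectPartition.empty m k).dual =
      if u = (RectPartition.empty m k).dual then 1 else 0 := by
  ext d
  rcases Nat.eq_zero_or_pos d with rfl | hd
  · rw [coeff_zero_repr_sigma τ hdeform]
    split_ifs <;> simp
  · have h0 : (τ.repr (QH.sigma α u) (RectPartition.empty m k).dual).coeff d = 0 := by
      by_contra h
      have h1 := weight_add_of_coeff_repr_sigma_ne_zero τ hdeg h
      have h2 := Nat.le_mul_of_pos_right (m + k) hd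
      have h3 := u.weight_le_weight_dual_empty
      omega
    rw [h0]
    split_ifs
    · simp [Polynomial.coeff_one, hd.ne']
    · simp

lemma eq_sum_repr (x : QH m k α) : x = ∑ v, τ.repr x v • τ v := (τ.sum_repr x).symm

/-- Duality of the classes `σ_u` with respect to the last coordinate in the basis `τ`; the
`ℚ[q]`-linear functional of `exists_trace` is a multiple of this coordinate. -/
lemma repr_sigma_mul_sigma (hm : 0 < m) (hdeg : ∀ a, (τ a).IsHomogeneous a.weight)
    (hdeform : ∀ a, τ a - QH.sigma α a ∈ Ideal.span {QH.q m k α}) (u v : RectPartition m k) :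
    τ.repr (QH.sigma α u * QH.sigma α v) (RectPartition.empty m k).dual =
      if v = u.dual then 1 else 0 := by
  obtain ⟨E, C, hC, hE⟩ := exists_trace (k := k) hm α
  set P := (RectPartition.empty m k).dual with hP
  set s : Matrix (RectPartition m k) (RectPartition m k) (Polynomial ℚ) :=
    Matrix.of fun u v => τ.repr (QH.sigma α u) v with hs
  -- The transition matrix is the identity at `q = 0`. A nonzero determinant over `ℚ[q]` is enough
  -- here: it is not needed that the `σ_u` form a basis.
  have hdet : s.det ≠ 0 := by
    intro h0
    have h1 := congrArg (Polynomial.constantCoeff) h0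
    rw [RingHom.map_det] at h1
    have h2 : Polynomial.constantCoeff.mapMatrix s = 1 := by
      ext u v
      simp [hs, Matrix.one_apply, coeff_zero_repr_sigma τ hdeform]
    rw [h2] at h1
    simp at h1
  -- `F` kills every `σ_u = σ_u · 1`: pairing with the empty partition and taking the `P`-coordinate
  -- both single out `u = P`. By `hdet` it then kills every `τ_v`.
  set F : QH m k α →ₗ[Polynomial ℚ] Polynomial ℚ :=
    E - Polynomial.C C • (Finsupp.lapply P ∘ₗ τ.repr.toLinearMap) with hF
  have hFa : ∀ x, F x = E x - Polynomial.C C * τ.repr x P := fun x => rfl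
  have hFs : ∀ u, F (QH.sigma α u) = 0 := by
    intro u
    have h1 := hE (RectPartition.empty m k) u
    rw [sigma_empty, one_mul] at h1
    rw [hFa, h1, repr_sigma_dual_empty τ hm hdeg hdeform]
    split_ifs <;> simp
  have hFτ : (fun v => F (τ v)) = 0 := by
    apply Matrix.eq_zero_of_mulVec_eq_zero hdet
    ext1 u
    have h1 := hFs u
    rw [eq_sum_repr τ (QH.sigma α u), map_sum] at h1
    simpa [Matrix.mulVec, dotProduct, hs] using h1
  have hF0 : F = 0 := τ.ext fun v => congrFun hFτ v
  have h1 : F (QH.sigma α u * QH.sigma α v) = 0 := by rw [hF0, LinearMap.zero_apply]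
  rw [hFa, hE, sub_eq_zero] at h1
  have hC' : Polynomial.C C ≠ 0 := by simpa using hC
  apply mul_left_cancel₀ hC'
  rw [← h1]
  split_ifs <;> simp

/-- An element with non-negative coordinates. -/
def IsNonneg (x : QH m k α) : Prop := ∀ v d, 0 ≤ (τ.repr x v).coeff d

lemma isNonneg_basis (u : RectPartition m k) : IsNonneg τ (τ u) := by
  intro v d
  rw [τ.repr_self, Finsupp.single_apply]
  split_ifs
  · rw [Polynomial.coeff_one]
    split_ifs <;> simp
  · simp

lemma IsNonneg.mul (hnonneg : ∀ u v w d, 0 ≤ structureConstant τ u v w d) {x y : QH m k α}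
    (hx : IsNonneg τ x) (hy : IsNonneg τ y) : IsNonneg τ (x * y) := by
  intro w d
  have hmul : ∀ p q : Polynomial ℚ, (∀ d, 0 ≤ p.coeff d) → (∀ d, 0 ≤ q.coeff d) →
      ∀ d, 0 ≤ (p * q).coeff d := fun p q hp hq d => by
    rw [Polynomial.coeff_mul]
    exact Finset.sum_nonneg fun i _ => mul_nonneg (hp _) (hq _)
  have h : x * y = ∑ u, ∑ v, (τ.repr x u * τ.repr y v) • (τ u * τ v) := by
    conv_lhs => rw [eq_sum_repr τ x, eq_sum_repr τ y, Finset.sum_mul_sum]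
    simp only [smul_mul_smul_comm]
  rw [h]
  simp only [map_sum, map_smul, Finsupp.coe_finsetSum, Finset.sum_apply, Finsupp.smul_apply,
    smul_eq_mul, Polynomial.finsetSum_coeff]
  exact Finset.sum_nonneg fun u _ => Finset.sum_nonneg fun v _ =>
    hmul _ _ (hmul _ _ (hx u) (hy v)) (hnonneg u v w) d

/-- Each factor has degree at most `k < m + k`, so it is itself a member of `τ`; this is where `0 <
m` enters. -/
lemma isNonneg_specialProd (hm : 0 < m) (hdeg : ∀ a, (τ a).IsHomogeneous a.weight)
    (hdeform : ∀ a, τ a - QH.sigma α a ∈ Ideal.span {QH.q m k α})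
    (hnonneg : ∀ u v w d, 0 ≤ structureConstant τ u v w d) (u : RectPartition m k) :
    IsNonneg τ (specialProd α u) := by
  have h : ∀ p : ℕ, p ≤ k → IsNonneg τ (specialClass m k α p) := by
    intro p hp
    obtain ⟨v, hv, hpv⟩ := specialClass_eq_sigma (α := α) hm hp
    rw [hpv, ← eq_sigma_of_weight_lt τ hdeg hdeform v (by omega)]
    exact isNonneg_basis τ v
  refine Finset.prod_induction _ (IsNonneg τ) (fun x y => IsNonneg.mul τ hnonneg) ?_
    fun i _ => h _ (u.2.2 i)
  rw [← specialClass_zero]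
  exact h 0 (Nat.zero_le k)

/-- Products of special classes are obtained from the `σ_v` by an invertible matrix. -/
lemma exists_specialProd_eq_sum_sigma
    (hdeform : ∀ a, τ a - QH.sigma α a ∈ Ideal.span {QH.q m k α}) :
    ∃ K : Matrix (RectPartition m k) (RectPartition m k) ℚ, IsUnit K ∧
      ∀ u, specialProd α u = ∑ v, Polynomial.C (K u v) • QH.sigma α v := by
  choose M hM using exists_sigma_eq_sum_specialProd (m := m) (k := k) α
  have hlin : ∀ x : RectPartition m k → ℚ, ∑ u, Polynomial.C (x u) • QH.sigma α u =
      ∑ v, Polynomial.C (Matrix.vecMul x (Matrix.of M) v) • specialProd α v := by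
    intro x
    have h1 : ∀ u, Polynomial.C (x u) • QH.sigma α u =
        ∑ v, Polynomial.C (x u * M u v) • specialProd α v := by
      intro u
      rw [hM u, Finset.smul_sum]
      simp only [smul_smul, map_mul]
    simp only [h1, Matrix.vecMul, dotProduct, map_sum, Finset.sum_smul, Matrix.of_apply]
    exact Finset.sum_comm
  -- A rational relation among the rows of `M` is a rational relation among the `σ_u`, which is
  -- trivial because their coordinates reduce to the identity at `q = 0`.
  have hunit : IsUnit (Matrix.of M) := by
    rw [← Matrix.vecMul_injective_iff_isUnit]
    refine (injective_iff_map_eq_zero (Matrix.vecMulLinear (Matrix.of M))).2 fun x hx => ?_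
    rw [Matrix.vecMulLinear_apply] at hx
    have h1 := hlin x
    simp only [hx, Pi.zero_apply, map_zero, zero_smul, Finset.sum_const_zero] at h1
    ext v
    have h2 := congrArg (fun y => (τ.repr y v).coeff 0) h1
    simpa [Polynomial.finsetSum_coeff, Polynomial.coeff_C_mul,
      coeff_zero_repr_sigma τ hdeform] using h2
  refine ⟨(Matrix.of M)⁻¹, Matrix.isUnit_nonsing_inv_iff.2 hunit, fun u => ?_⟩
  have h1 := hlin ((Matrix.of M)⁻¹ u)
  have h2 : Matrix.vecMul ((Matrix.of M)⁻¹ u) (Matrix.of M) = Pi.single u 1 := by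
    have h3 := Matrix.nonsing_inv_mul (Matrix.of M) ((Matrix.isUnit_iff_isUnit_det _).1 hunit)
    ext v
    have h4 := congrFun (congrFun h3 u) v
    rw [Matrix.mul_apply] at h4
    rw [Matrix.vecMul, dotProduct, h4, Matrix.one_apply, Pi.single_apply]
    simp only [eq_comm]
  rw [h1, h2, Finset.sum_eq_single u (fun v _ hv => by simp [hv]) (by simp)]
  simp

lemma coeff_mul_of_coeff_eq_zero {p q : Polynomial ℚ} {d : ℕ} (hd : 0 < d)
    (hp : ∀ e, 0 < e → e < d → p.coeff e = 0) :
    (p * q).coeff d = p.coeff 0 * q.coeff d + p.coeff d * q.coeff 0 := by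
  obtain ⟨e, rfl⟩ := Nat.exists_eq_succ_of_ne_zero hd.ne'
  rw [Polynomial.coeff_mul, Finset.Nat.sum_antidiagonal_eq_sum_range_succ
    (fun i j => p.coeff i * q.coeff j), Finset.sum_range_succ, Finset.sum_range_succ',
    Finset.sum_eq_zero]
  · simp
  · intro i hi
    rw [hp (i + 1) (Nat.succ_pos i) (by simpa using hi), zero_mul]

/-- A matrix squeezed between sign conditions after multiplication by non-negative invertible
matrices on either side vanishes. -/
lemma eq_zero_of_mul_nonneg_of_mul_nonpos {ι : Type*} [Fintype ι] [DecidableEq ι]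
    {K A L : Matrix ι ι ℚ} (hK : IsUnit K) (hL : IsUnit L) (hK0 : ∀ i j, 0 ≤ K i j)
    (hL0 : ∀ i j, 0 ≤ L i j) (hKA : ∀ i j, 0 ≤ (K * A) i j) (hAL : ∀ i j, (A * L) i j ≤ 0) :
    A = 0 := by
  have h : K * A * L = 0 := by
    ext i j
    apply le_antisymm
    · rw [Matrix.mul_assoc, Matrix.mul_apply]
      exact Finset.sum_nonpos fun l _ => mul_nonpos_of_nonneg_of_nonpos (hK0 i l) (hAL l j)
    · rw [Matrix.mul_apply]
      exact Finset.sum_nonneg fun l _ => mul_nonneg (hKA i l) (hL0 l j)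
  rwa [hL.mul_left_eq_zero, hK.mul_right_eq_zero] at h

/-- Induction on `d`: once the intermediate coefficients vanish, only two terms of each product
contribute to `q^d`, and the unknown matrix `A` enters linearly. -/
lemma coeff_repr_sigma_eq_zero (hm : 0 < m) (hdeg : ∀ a, (τ a).IsHomogeneous a.weight)
    (hdeform : ∀ a, τ a - QH.sigma α a ∈ Ideal.span {QH.q m k α})
    (hnonneg : ∀ u v w d, 0 ≤ structureConstant τ u v w d) (d : ℕ) (hd : 0 < d) :
    ∀ u v, (τ.repr (QH.sigma α u) v).coeff d = 0 := by
  induction d using Nat.strong_induction_on with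
  | _ d ih =>
  obtain ⟨K, hK, hKsum⟩ := exists_specialProd_eq_sum_sigma τ hdeform
  set P := (RectPartition.empty m k).dual with hP
  have hrepr : ∀ r v, τ.repr (specialProd α r) v =
      ∑ u, Polynomial.C (K r u) * τ.repr (QH.sigma α u) v := by
    intro r v
    rw [hKsum]
    simp
  -- By duality this coordinate is free of `q`, so its coefficients of positive powers of `q` give
  -- homogeneous equations.
  have hpair : ∀ r u, τ.repr (specialProd α r * QH.sigma α u) P = Polynomial.C (K r u.dual) := by
    intro r u
    rw [hKsum, Finset.sum_mul]
    simp only [smul_mul_assoc, map_sum, map_smul, Finsupp.coe_finsetSum, Finset.sum_apply,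
      Finsupp.smul_apply, smul_eq_mul, hP, repr_sigma_mul_sigma τ hm hdeg hdeform,
      RectPartition.eq_dual_iff (v := u)]
    simp
  have hexpand : ∀ r u, Polynomial.C (K r u.dual) =
      ∑ v, τ.repr (QH.sigma α u) v * τ.repr (specialProd α r * τ v) P := by
    intro r u
    rw [← hpair]
    conv_lhs => rw [eq_sum_repr τ (QH.sigma α u), Finset.mul_sum]
    simp
  have h0 : ∀ r u, (τ.repr (specialProd α r * τ u) P).coeff 0 = K r u.dual := by
    intro r u
    have h := congrArg (fun p => Polynomial.coeff p 0) (hexpand r u)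
    simp only [Polynomial.coeff_C_zero, Polynomial.finsetSum_coeff, Polynomial.mul_coeff_zero,
      coeff_zero_repr_sigma τ hdeform] at h
    simpa using h.symm
  -- The constant terms of the coordinates of the special products are the entries of `K`.
  have hKnonneg : ∀ r v, 0 ≤ K r v := by
    intro r v
    have h := isNonneg_specialProd τ hm hdeg hdeform hnonneg r v 0
    simpa [hrepr, Polynomial.finsetSum_coeff, coeff_zero_repr_sigma τ hdeform] using h
  set A : Matrix (RectPartition m k) (RectPartition m k) ℚ :=
    Matrix.of fun u v => (τ.repr (QH.sigma α u) v).coeff d with hA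
  set L := Matrix.submatrix K.transpose (RectPartition.dualEquiv m k) (Equiv.refl _) with hL
  have hLr : ∀ u r, L u r = K r u.dual := fun _ _ => rfl
  have hLunit : IsUnit L := by
    rw [hL, Matrix.isUnit_submatrix_equiv, Matrix.isUnit_transpose]
    exact hK
  have hA0 : A = 0 := by
    refine eq_zero_of_mul_nonneg_of_mul_nonpos hK hLunit hKnonneg (fun u r => hKnonneg _ _) ?_ ?_
    · intro r v
      have h := isNonneg_specialProd τ hm hdeg hdeform hnonneg r v d
      simpa [hrepr, Polynomial.finsetSum_coeff, Matrix.mul_apply, hA] using h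
    -- The coefficient of `q^d` in `hexpand` reads `0 = (P-coordinate of specialProd_r τ_u)_d + (A
    -- L)_{ur}`, and the first summand is non-negative.
    · intro u r
      have h := congrArg (fun p => Polynomial.coeff p d) (hexpand r u)
      simp only [Polynomial.coeff_C_of_ne_zero hd.ne', Polynomial.finsetSum_coeff] at h
      have h1 : ∀ v, (τ.repr (QH.sigma α u) v * τ.repr (specialProd α r * τ v) P).coeff d =
          (if u = v then (τ.repr (specialProd α r * τ v) P).coeff d else 0) + A u v * L v r := by
        intro v
        rw [coeff_mul_of_coeff_eq_zero hd (fun e he0 hed => ih e hed he0 u v),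
          coeff_zero_repr_sigma τ hdeform, h0, hLr, ite_mul, one_mul, zero_mul]
        rfl
      simp only [h1, Finset.sum_add_distrib, Finset.sum_ite_eq, Finset.mem_univ, if_true] at h
      have h2 := IsNonneg.mul τ hnonneg (isNonneg_specialProd τ hm hdeg hdeform hnonneg r)
        (isNonneg_basis τ u) P d
      rw [Matrix.mul_apply]
      linarith
  intro u v
  exact congrFun (congrFun hA0 u) v

/-- For `m = k = 0` there is no such basis. -/
lemma isEmpty_basis_zero_zero (α : ℚ) :
    IsEmpty (Module.Basis (RectPartition 0 0) (Polynomial ℚ) (QH 0 0 α)) := by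
  refine ⟨fun τ => ?_⟩
  -- With `m = k = 0` the only relation is `σ_0 + α q = 1 + α q`, so this polynomial annihilates the
  -- ring, although its constant term is `1`.
  have h : ((1 : Polynomial ℚ) + Polynomial.C α * Polynomial.X) •
      τ (RectPartition.empty 0 0) = 0 := by
    rw [Algebra.smul_def]
    have h1 : algebraMap (Polynomial ℚ) (QH 0 0 α)
        (1 + Polynomial.C α * Polynomial.X) = 0 := by
      change QH.mk 0 0 α (Polynomial.map MvPolynomial.C (1 + Polynomial.C α * Polynomial.X)) = 0
      refine Ideal.Quotient.eq_zero_iff_mem.2 (Ideal.subset_span (Or.inr ?_))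
      simp [sigma, Delta]
    rw [h1, zero_mul]
  have h2 := congrArg (fun y => (τ.repr y (RectPartition.empty 0 0)).coeff 0) h
  simp at h2

end Basis

end

end QuantumGrassmannian

open QuantumGrassmannian in
theorem mainTheorem1 (m k : ℕ) (α : ℚ)
    (τ : Module.Basis (QuantumGrassmannian.RectPartition m k) (Polynomial ℚ)
      (QuantumGrassmannian.QH m k α))
    (hdeg : ∀ a, (τ a).IsHomogeneous a.weight)
    (hdeform : ∀ a, τ a - QuantumGrassmannian.QH.sigma α a ∈
      Ideal.span {QuantumGrassmannian.QH.q m k α})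
    (hnonneg : ∀ u v w d, 0 ≤ QuantumGrassmannian.structureConstant τ u v w d) :
    ∀ a, τ a = QuantumGrassmannian.QH.sigma α a := by
  intro a
  rcases Nat.eq_zero_or_pos m with rfl | hm
  · rcases Nat.eq_zero_or_pos k with rfl | hk
    · exact ((isEmpty_basis_zero_zero α).false τ).elim
    -- For `m = 0` the only partition is empty, of weight `0 < k = n`.
    · exact eq_sigma_of_weight_lt τ hdeg hdeform a (by simpa [RectPartition.weight] using hk)
  · exact eq_sigma_of_coeff_eq_zero τ hdeform a fun v d hd =>
      coeff_repr_sigma_eq_zero τ hm hdeg hdeform hnonneg d hd a v
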